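/- Let $U=\{(\alpha,\beta)\in\mathbb{R}^2 : 0\le\beta\le\alpha\le 1\}$ with interior $U^\circ$. For $(\alpha,\beta)\in U$ let $T_{\alpha,\beta}:[0,1)\to[0,1)$ be the interval translation map $$T_{\alpha,\beta}(x)=\begin{cases}x+\alpha & \text{if } x\in[0,1-\alpha),\\ x+\beta & \text{if } x\in[1-\alpha,1-\beta),\\ x+\beta-1 & \text{if } x\in[1-\beta,1).\end{cases}$$ Put $\Omega_0=[0,1)$ and $\Omega_{n+1}=T_{\alpha,\beta}(\Omega_n)$; $T_{\alpha,\beta}$ is said to be of finite type if $\Omega_n=\Omega_{n+1}$ for some $n\ge 0$, and aperiodic if it has no periodic point in $[0,1)$. Let $G$ be the Gauss map, defined for $(\alpha,\beta)\in U^\circ$ by $$G(\alpha,\beta)=\left(\frac{\beta}{\alpha},\ \frac{\beta-1}{\alpha}+\left\lfloor\frac1\alpha\right\rfloor\right),$$ and let $A=\bigcap_{n\ge 0}G^{-n}(U^\circ)$ be the set of $(\alpha,\beta)\in U^\circ$ all of whose iterates under $G$ lie in $U^\circ$. Then $A$ has Lebesgue measure zero. Moreover, for Lebesgue-almost every $(\alpha,\beta)\in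 U$ the map $T_{\alpha,\beta}$ is of finite type and aperiodic. -/

import Mathlib

open Set MeasureTheory

namespace ITM

/-- The stages `Ω₀ = [0,1)`, `Ωₙ₊₁ = T(Ωₙ)` of a map `T` of the interval `[0,1)`.
Maps of `[0,1)` are represented by functions `ℝ → ℝ` that send `[0,1)` into itself; their values
off `[0,1)` play no role. -/
def stage (T : ℝ → ℝ) : ℕ → Set ℝ
  | 0 => Ico 0 1
  | n + 1 => T '' stage T n

/-- `T` is of finite type if `Ωₙ = Ωₙ₊₁` for some `n`. -/
def IsFiniteType (T : ℝ → ℝ) : Prop :=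
  ∃ n : ℕ, stage T n = stage T (n + 1)

/-- `T` is aperiodic if it has no periodic point in `[0,1)`, i.e. no `x ∈ [0,1)` with
`Tⁿ x = x` for some `n ≥ 1`. -/
def IsAperiodic (T : ℝ → ℝ) : Prop :=
  ∀ x ∈ Ico (0 : ℝ) 1, x ∉ Function.periodicPts T

/-- The parameter triangle `U = {(α, β) : 0 ≤ β ≤ α ≤ 1}`. -/
def U : Set (ℝ × ℝ) :=
  {p | 0 ≤ p.2 ∧ p.2 ≤ p.1 ∧ p.1 ≤ 1}

/-- The interval translation map `T_{α,β}` on `[0,1)`. -/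
noncomputable def T (α β : ℝ) (x : ℝ) : ℝ :=
  if x < 1 - α then x + α
  else if x < 1 - β then x + β
  else x + β - 1

/-- For parameters in `U`, the map `T_{α,β}` does send `[0,1)` into itself. -/
theorem mapsTo_T {α β : ℝ} (h : (α, β) ∈ U) : MapsTo (T α β) (Ico 0 1) (Ico 0 1) := by
  obtain ⟨h0, h1, h2⟩ := h
  simp only at h0 h1 h2
  rintro x ⟨hx0, hx1⟩
  unfold T
  split_ifs <;> constructor <;> linarith

/-- The Gauss map `G(α, β) = (β / α, (β - 1) / α + ⌊1 / α⌋)`, used only at points of the interior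
of `U`, where `α > 0`. -/
noncomputable def G (p : ℝ × ℝ) : ℝ × ℝ :=
  (p.2 / p.1, (p.2 - 1) / p.1 + (⌊1 / p.1⌋ : ℝ))

/-- `A = ⋂ₙ G⁻ⁿ(U°)`: the parameters all of whose iterates under `G` (including the zeroth) lie in
the interior `U°` of `U`. As `n` ranges over all of `ℕ`, a point of `A` has its whole orbit inside
the domain `U°` of the Gauss map, so the values of `G` elsewhere are irrelevant. -/
def A : Set (ℝ × ℝ) :=
  ⋂ n : ℕ, (G^[n]) ⁻¹' (interior U)

end ITM

/-!
Homogeneous coordinates `(t, tα, tβ)` turn the Gauss map into a linear multidimensional continued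
fraction: its inverse branches are matrices of determinant `-1` (`branchMatrix`), and the cone over
`A` is contained in the union of its images under them. In these coordinates, let `V(x, y, z)` be
the volume of the part of the cone on which the linear form with values `x, y, z` on the edges
`(1, 0, 0)`, `(1, 1, 0)`, `(1, 1, 1)` of the cone over `U` is at most `1`. Changing variables,
`V(x, y, z) ≤ ∑ₖ V(kx + y, (k+1)x + z, kx + z)` (`volume_truncation_le_tsum`), and
`V(x, y, z) ≤ 1 / (xyz)` because the truncated cone lies in a box.

The weights `w(x, y, z) = 1 / (xyz)` satisfy `∑ₖ w(stepₖ) ≤ w`, the sum being dominated by a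
telescoping one (`weight_step_add`). The loss in this inequality is the part of the triangle that
`G` sends out of `U`. When `x ≤ 4z` the loss is at least `w / 24`. This comparison holds after any
step with `k ≥ 1`, thanks to inequalities preserved by all steps (`IsAdmissible`). Steps with `k = 0`
come from the parabolic fixed point `(1, 1)` of `G` and give no uniform loss, but the weight of a
long run of them tends to `0`. So a bound `V ≤ C w` for all admissible triples improves to
`V ≤ (23/24) C w` (`volume_truncation_improve`). Hence `V = 0`, and slicing the cone gives
`volume A = 0`.

For the second claim, almost every `(α, β)` satisfies no rational affine relation (`RatIndep`).
Then `T` is aperiodic, because `Tⁿ x - x = iα + jβ - l` with `i + j = n`, and no iterate of `G`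
meets the boundary of `U`. The first return map of `T` to `[1 - α, 1)` is, up to scaling,
`T_{G(α, β)}` if `G(α, β) ∈ U°`. If the second coordinate of `G(α, β)` is negative, it is instead a
two-interval map that acts as a rotation on an interval absorbing everything. Finite type passes
from the return map to `T` (`IsFiniteType.of_renormalization`), so it holds for every
independent parameter whose `G`-orbit leaves `U°`, that is, outside the null set `A`.
-/

namespace ITM

/-! ### The cone over the surviving parameters -/

/-- The matrix of the inverse branch of `G` with digit `k + 1`, acting on the homogeneous
coordinates `(t, tα, tβ)` of `(α, β)`. Digits are `⌊1 / α⌋ ≥ 1`, and the shift by one lets the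
index run over `ℕ`. -/
def branchMatrix (k : ℕ) : Matrix (Fin 3) (Fin 3) ℝ :=
  !![(k : ℝ) + 1, 1, -1; 1, 0, 0; 0, 1, 0]

theorem det_branchMatrix (k : ℕ) : (branchMatrix k).det = -1 := by
  simp [branchMatrix, Matrix.det_fin_three]

theorem toLin'_branchMatrix (k : ℕ) (v : Fin 3 → ℝ) :
    Matrix.toLin' (branchMatrix k) v = ![(k + 1) * v 0 + v 1 - v 2, v 0, v 1] := by
  ext i
  fin_cases i <;>
    simp [branchMatrix, Matrix.toLin'_apply, Matrix.mulVec, dotProduct, Fin.sum_univ_three]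
  ring

/-- The part of `B` where the linear form with values `x`, `y`, `z` at `(1, 0, 0)`, `(1, 1, 0)`,
`(1, 1, 1)` is at most `1`. These vectors span the cone over the triangle `U`. -/
def truncation (B : Set (Fin 3 → ℝ)) (x y z : ℝ) : Set (Fin 3 → ℝ) :=
  {v ∈ B | x * (v 0 - v 1) + y * (v 1 - v 2) + z * v 2 ≤ 1}

/-- `B` lies in the open cone over the interior of `U`, and each of its points is the image of a
point of `B` under some inverse branch of the Gauss map. -/
structure IsBranchInvariant (B : Set (Fin 3 → ℝ)) : Prop where
  pos : ∀ v ∈ B, 0 < v 2 ∧ v 2 < v 1 ∧ v 1 < v 0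
  subset : ∀ v ∈ B, ∃ k : ℕ, ∃ w ∈ B, v = Matrix.toLin' (branchMatrix k) w

variable {B : Set (Fin 3 → ℝ)} {x y z : ℝ}

theorem volume_truncation_le_tsum (hB : IsBranchInvariant B) (x y z : ℝ) :
    volume (truncation B x y z) ≤
      ∑' k : ℕ, volume (truncation B (k * x + y) ((k + 1) * x + z) (k * x + z)) := by
  have hsub : truncation B x y z ⊆ ⋃ k : ℕ, Matrix.toLin' (branchMatrix k) ''
      truncation B (k * x + y) ((k + 1) * x + z) (k * x + z) := by
    rintro v ⟨hv, hle⟩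
    obtain ⟨k, w, hw, rfl⟩ := hB.subset v hv
    refine mem_iUnion.2 ⟨k, w, ⟨hw, ?_⟩, rfl⟩
    rw [toLin'_branchMatrix] at hle
    simp only [Matrix.cons_val_zero, Matrix.cons_val_one, Matrix.cons_val] at hle
    linarith
  refine (measure_mono hsub).trans ((measure_iUnion_le _).trans (ENNReal.tsum_le_tsum fun k => ?_))
  rw [Measure.addHaar_image_linearMap, LinearMap.det_toLin', det_branchMatrix]
  simp

/-- In the coordinates `(t - a, a - b, b)` the truncated cone lies in a box with sides
`1 / x`, `1 / y`, `1 / z`. -/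
theorem volume_truncation_le (hB : IsBranchInvariant B) (hx : 0 < x) (hy : 0 < y)
    (hz : 0 < z) : volume (truncation B x y z) ≤ ENNReal.ofReal (1 / (x * y * z)) := by
  let M : Matrix (Fin 3) (Fin 3) ℝ := !![1, 1, 1; 0, 1, 1; 0, 0, 1]
  have hM : M.det = 1 := by simp [M, Matrix.det_fin_three]
  have hsub : truncation B x y z ⊆ Matrix.toLin' M '' Icc 0 ![1 / x, 1 / y, 1 / z] := by
    rintro v ⟨hv, hle⟩
    obtain ⟨h2, h1, h0⟩ := hB.pos v hv
    have hr : 0 < x * (v 0 - v 1) := mul_pos hx (sub_pos.2 h0)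
    have hs : 0 < y * (v 1 - v 2) := mul_pos hy (sub_pos.2 h1)
    have hw : 0 < z * v 2 := mul_pos hz h2
    refine ⟨![v 0 - v 1, v 1 - v 2, v 2], ⟨?_, ?_⟩, ?_⟩
    · intro i
      fin_cases i <;> simp <;> linarith
    · intro i
      fin_cases i
      · simp only [Fin.zero_eta, Matrix.cons_val_zero]
        rw [le_div_iff₀ hx]; linarith
      · simp only [Fin.mk_one, Matrix.cons_val_one, Matrix.cons_val_zero]
        rw [le_div_iff₀ hy]; linarith
      · simp only [Fin.reduceFinMk, Matrix.cons_val]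
        rw [le_div_iff₀ hz]; linarith
    · ext i
      fin_cases i <;>
        simp [M, Matrix.toLin'_apply, Matrix.mulVec, dotProduct, Fin.sum_univ_three]
  refine (measure_mono hsub).trans ?_
  rw [Measure.addHaar_image_linearMap, LinearMap.det_toLin', hM, Real.volume_Icc_pi,
    Fin.prod_univ_three]
  simp only [abs_one, ENNReal.ofReal_one, one_mul, Pi.zero_apply, sub_zero, Matrix.cons_val_zero,
    Matrix.cons_val_one, Matrix.cons_val]
  rw [← ENNReal.ofReal_mul (by positivity), ← ENNReal.ofReal_mul (by positivity)]
  apply le_of_eq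
  congr 1
  field_simp

/-! ### Weights of cylinders -/

/-- Inequalities between the values of a linear form on the three edges of the cone that hold for
`(1, 1, 1)` and are preserved by every inverse branch. They make `x` and `y` comparable and at least
`z`; the value `z` at the vertex `(1, 1)`, a parabolic fixed point of `G`, may be much smaller. -/
structure IsAdmissible (x y z : ℝ) : Prop where
  pos : 0 < z
  le_left : z ≤ x
  le_mid : z ≤ y
  mid_le : y ≤ 2 * x
  left_le : x + z ≤ 2 * y

theorem IsAdmissible.left_pos (h : IsAdmissible x y z) : 0 < x := h.pos.trans_le h.le_left

theorem IsAdmissible.mid_pos (h : IsAdmissible x y z) : 0 < y := h.pos.trans_le h.le_mid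

theorem IsAdmissible.step (h : IsAdmissible x y z) (k : ℕ) :
    IsAdmissible (k * x + y) ((k + 1) * x + z) (k * x + z) := by
  have hk : 0 ≤ k * x := mul_nonneg k.cast_nonneg h.left_pos.le
  obtain ⟨h1, h2, h3, h4, h5⟩ := h
  constructor <;> nlinarith

/-- After a digit at least `2` all three values of the linear form are comparable. -/
theorem IsAdmissible.step_succ_le (h : IsAdmissible x y z) (k : ℕ) :
    ((k + 1 : ℕ) : ℝ) * x + y ≤ 4 * (((k + 1 : ℕ) : ℝ) * x + z) := by
  have hk : 0 ≤ k * x := mul_nonneg k.cast_nonneg h.left_pos.le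
  obtain ⟨h1, h2, h3, h4, h5⟩ := h
  push_cast
  nlinarith

/-- The strip of `U` with `⌊1 / α⌋ = k + 1` consists of a triangle mapped onto `U` by `G` and a
triangle mapped outside `U`. The terms on the left are the weights of these two triangles. -/
theorem weight_step_add (hx : 0 < x) (hy : 0 < y) (hz : 0 < z) (k : ℕ) :
    1 / ((k * x + y) * ((k + 1) * x + z) * (k * x + z)) +
        1 / ((k * x + y) * ((k + 1) * x + z) * ((k + 1) * x + y)) =
      1 / (x * (k * x + y) * (k * x + z)) -
        1 / (x * ((k + 1 : ℕ) * x + y) * ((k + 1 : ℕ) * x + z)) := by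
  push_cast
  have hk : 0 ≤ k * x := mul_nonneg k.cast_nonneg hx.le
  have h1 : 0 < k * x + y := by linarith
  have h2 : 0 < k * x + z := by linarith
  have h3 : 0 < (k + 1) * x + y := by linarith
  have h4 : 0 < (k + 1) * x + z := by linarith
  rw [div_add_div _ _ (by positivity) (by positivity), div_sub_div _ _ (by positivity)
    (by positivity), div_eq_div_iff (by positivity) (by positivity)]
  ring

theorem sum_weight_step_le (h : IsAdmissible x y z) (n : ℕ) :
    ∑ k ∈ Finset.range n, 1 / ((k * x + y) * ((k + 1) * x + z) * (k * x + z)) ≤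
      1 / (x * y * z) := by
  have hx := h.left_pos
  have hy := h.mid_pos
  have hz := h.pos
  have key : ∑ k ∈ Finset.range n, 1 / ((k * x + y) * ((k + 1) * x + z) * (k * x + z)) ≤
      ∑ k ∈ Finset.range n, (1 / (x * (k * x + y) * (k * x + z)) -
        1 / (x * ((k + 1 : ℕ) * x + y) * ((k + 1 : ℕ) * x + z))) := by
    refine Finset.sum_le_sum fun k _ => ?_
    rw [← weight_step_add hx hy hz]
    exact le_add_of_nonneg_right (by positivity)
  rw [Finset.sum_range_sub'] at key
  refine key.trans ?_
  have : 0 ≤ 1 / (x * (n * x + y) * (n * x + z)) := by positivity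
  simpa using this

/-- When the three values are comparable, the triangle with digit `1` that leaves `U` already
carries a fixed proportion of the weight. -/
theorem sum_weight_step_le_of_le (h : IsAdmissible x y z) (hxz : x ≤ 4 * z) (n : ℕ) :
    ∑ k ∈ Finset.range n, 1 / ((k * x + y) * ((k + 1) * x + z) * (k * x + z)) ≤
      23 / 24 * (1 / (x * y * z)) := by
  have hx := h.left_pos
  have hy := h.mid_pos
  have hz := h.pos
  have hgap : 1 / 24 * (1 / (x * y * z)) ≤ 1 / (y * (x + z) * (x + y)) := by
    rw [div_mul_div_comm, div_le_div_iff₀ (by positivity) (by positivity)]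
    have h1 : x + z ≤ 2 * x := by linarith [h.le_left]
    have h2 : x + y ≤ 3 * x := by linarith [h.mid_le]
    have h3 : (x + z) * (x + y) ≤ (2 * x) * (3 * x) := by gcongr
    have h4 : x * x ≤ x * (4 * z) := by gcongr
    nlinarith
  rcases n with _ | n
  · simp only [Finset.range_zero, Finset.sum_empty]; positivity
  have key : ∑ k ∈ Finset.range n, 1 / (((k + 1 : ℕ) * x + y) * (((k + 1 : ℕ) + 1) * x + z) *
      ((k + 1 : ℕ) * x + z)) ≤
      ∑ k ∈ Finset.range n, (1 / (x * ((k + 1 : ℕ) * x + y) * ((k + 1 : ℕ) * x + z)) -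
        1 / (x * ((k + 1 + 1 : ℕ) * x + y) * ((k + 1 + 1 : ℕ) * x + z))) := by
    refine Finset.sum_le_sum fun k _ => ?_
    rw [← weight_step_add hx hy hz (k + 1)]
    exact le_add_of_nonneg_right (by positivity)
  rw [Finset.sum_range_sub' (fun k : ℕ => 1 / (x * ((k + 1 : ℕ) * x + y) * ((k + 1 : ℕ) * x + z)))]
    at key
  have hzero := weight_step_add hx hy hz 0
  have hn : 0 ≤ 1 / (x * ((n + 1 : ℕ) * x + y) * ((n + 1 : ℕ) * x + z)) := by positivity
  rw [Finset.sum_range_succ']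
  simp only [Nat.cast_zero, zero_mul, zero_add, one_mul, Nat.cast_one] at hzero key ⊢
  linarith

/-! ### Vanishing of the volume -/

theorem volume_truncation_le_of_sum_le (hB : IsBranchInvariant B) (u : ℕ → ℝ) (C : ℝ)
    (hu : ∀ k : ℕ,
      volume (truncation B (k * x + y) ((k + 1) * x + z) (k * x + z)) ≤ ENNReal.ofReal (u k))
    (hu0 : ∀ k, 0 ≤ u k) (hC : ∀ n, ∑ k ∈ Finset.range n, u k ≤ C) :
    volume (truncation B x y z) ≤ ENNReal.ofReal C := by
  refine (volume_truncation_le_tsum hB x y z).trans ((ENNReal.tsum_le_tsum hu).trans ?_)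
  refine ENNReal.tsum_le_of_sum_range_le fun n => ?_
  rw [← ENNReal.ofReal_sum_of_nonneg fun k _ => hu0 k]
  exact ENNReal.ofReal_le_ofReal (hC n)

/-- A bound of the volumes by a multiple of the weight, valid for all admissible triples, can be
multiplied by `23 / 24`. -/
theorem volume_truncation_improve (hB : IsBranchInvariant B) {C : ℝ} (hC : 0 ≤ C)
    (hV : ∀ x y z, IsAdmissible x y z →
      volume (truncation B x y z) ≤ ENNReal.ofReal (C * (1 / (x * y * z))))
    (h : IsAdmissible x y z) :
    volume (truncation B x y z) ≤ ENNReal.ofReal (23 / 24 * C * (1 / (x * y * z))) := by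
  have hw : ∀ {x y z : ℝ}, IsAdmissible x y z → 0 ≤ 1 / (x * y * z) := fun h => by
    have hx := h.left_pos
    have hy := h.mid_pos
    have hz := h.pos
    positivity
  have good : ∀ x y z, IsAdmissible x y z → x ≤ 4 * z →
      volume (truncation B x y z) ≤ ENNReal.ofReal (23 / 24 * C * (1 / (x * y * z))) := by
    intro x y z h hxz
    refine volume_truncation_le_of_sum_le hB _ _ (fun k => hV _ _ _ (h.step k))
      (fun k => mul_nonneg hC (hw (h.step k))) fun n => ?_
    rw [← Finset.mul_sum]
    have := mul_le_mul_of_nonneg_left (sum_weight_step_le_of_le h hxz n) hC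
    linarith
  -- The digits `k ≥ 1` are covered by `good`, so an excess over the improved bound can only be
  -- passed on through the digit `k = 0`.
  have one : ∀ x y z D, 0 ≤ D → IsAdmissible x y z →
      volume (truncation B y (x + z) z) ≤
        ENNReal.ofReal (23 / 24 * C * (1 / (y * (x + z) * z)) + D) →
      volume (truncation B x y z) ≤ ENNReal.ofReal (23 / 24 * C * (1 / (x * y * z)) + D) := by
    intro x y z D hD h h1
    refine volume_truncation_le_of_sum_le hB (fun k => 23 / 24 * C *
      (1 / ((k * x + y) * ((k + 1) * x + z) * (k * x + z))) + if k = 0 then D else 0) _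
      (fun k => ?_) (fun k => ?_) fun n => ?_
    · rcases k with _ | k
      · simpa using h1
      · simpa using good _ _ _ (h.step (k + 1)) (h.step_succ_le k)
    · have := hw (h.step k)
      split_ifs <;> positivity
    · rw [Finset.sum_add_distrib, ← Finset.mul_sum]
      have h2 := mul_le_mul_of_nonneg_left (sum_weight_step_le h n)
        (by positivity : 0 ≤ 23 / 24 * C)
      have h3 : (∑ k ∈ Finset.range n, if k = 0 then D else 0) ≤ D := by
        rw [Finset.sum_ite_eq']
        split_ifs <;> linarith
      linarith
  -- Two steps with `k = 0` add `z` to `x` and to `y`. After `2 * m` of them the excess is at most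
  -- `C` times a weight that tends to `0` as `m` grows.
  have two : ∀ m : ℕ, ∀ x y z, IsAdmissible x y z →
      volume (truncation B x y z) ≤
        ENNReal.ofReal (23 / 24 * C * (1 / (x * y * z)) +
          C * (1 / ((x + m * z) * (y + m * z) * z))) := by
    intro m
    induction m with
    | zero =>
      intro x y z h
      refine (hV x y z h).trans (ENNReal.ofReal_le_ofReal ?_)
      have := mul_nonneg hC (hw h)
      simp only [Nat.cast_zero, zero_mul, add_zero]
      linarith
    | succ m ih =>
      intro x y z h
      have h1 : IsAdmissible y (x + z) z := by simpa using h.step 0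
      have h2 : IsAdmissible (x + z) (y + z) z := by simpa using h1.step 0
      have hx := h.left_pos
      have hy := h.mid_pos
      have hz := h.pos
      refine one x y z _ (by positivity) h (one y (x + z) z _ (by positivity) h1 ?_)
      convert ih (x + z) (y + z) z h2 using 7 <;> push_cast <;> ring
  have hlim : Filter.Tendsto (fun m : ℕ => ENNReal.ofReal (23 / 24 * C * (1 / (x * y * z)) +
      C * (1 / ((x + m * z) * (y + m * z) * z)))) Filter.atTop
      (nhds (ENNReal.ofReal (23 / 24 * C * (1 / (x * y * z)) + C * 0))) := by
    refine (ENNReal.continuous_ofReal.tendsto _).comp ((Filter.Tendsto.const_mul _ ?_).const_add _)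
    have hz := h.pos
    have hinf : ∀ a : ℝ, Filter.Tendsto (fun m : ℕ => a + m * z) Filter.atTop Filter.atTop :=
      fun a => Filter.tendsto_atTop_add_const_left _ _
        (tendsto_natCast_atTop_atTop.atTop_mul_const hz)
    simp only [one_div]
    exact (((hinf x).atTop_mul_atTop₀ (hinf y)).atTop_mul_const hz).inv_tendsto_atTop
  rw [mul_zero, add_zero] at hlim
  exact ge_of_tendsto' hlim fun m => two m x y z h

theorem volume_truncation_eq_zero (hB : IsBranchInvariant B) (h : IsAdmissible x y z) :
    volume (truncation B x y z) = 0 := by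
  have key : ∀ n : ℕ, ∀ x y z, IsAdmissible x y z →
      volume (truncation B x y z) ≤ ENNReal.ofReal ((23 / 24) ^ n * (1 / (x * y * z))) := by
    intro n
    induction n with
    | zero =>
      intro x y z h
      simpa using volume_truncation_le hB h.left_pos h.mid_pos h.pos
    | succ n ih =>
      intro x y z h
      rw [pow_succ']
      exact volume_truncation_improve hB (by positivity) ih h
  have hlim : Filter.Tendsto (fun n : ℕ => ENNReal.ofReal ((23 / 24) ^ n * (1 / (x * y * z))))
      Filter.atTop (nhds (ENNReal.ofReal (0 * (1 / (x * y * z))))) :=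
    (ENNReal.continuous_ofReal.tendsto _).comp
      ((tendsto_pow_atTop_nhds_zero_of_lt_one (by norm_num) (by norm_num)).mul_const _)
  rw [zero_mul, ENNReal.ofReal_zero] at hlim
  exact le_antisymm (ge_of_tendsto' hlim fun n => key n x y z h) bot_le

/-! ### The set `A` is null -/

theorem mem_interior_U {p : ℝ × ℝ} : p ∈ interior U ↔ 0 < p.2 ∧ p.2 < p.1 ∧ p.1 < 1 := by
  constructor
  · intro hp
    rw [mem_interior_iff_mem_nhds, Metric.mem_nhds_iff] at hp
    obtain ⟨ε, hε, hball⟩ := hp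
    have hmem : ∀ a b : ℝ, |a| < ε → |b| < ε → (p.1 + a, p.2 + b) ∈ U := fun a b ha hb =>
      hball (by simp [Prod.dist_eq, ha, hb])
    have h1 := hmem (ε / 2) (-(ε / 2)) (by rw [abs_of_pos] <;> linarith)
      (by rw [abs_neg, abs_of_pos] <;> linarith)
    have h2 := hmem 0 (ε / 2) (by simpa) (by rw [abs_of_pos] <;> linarith)
    simp only [U, mem_ofPred_eq] at h1 h2
    refine ⟨?_, ?_, ?_⟩ <;> linarith
  · rintro ⟨h0, h1, h2⟩
    have hopen : IsOpen {p : ℝ × ℝ | 0 < p.2 ∧ p.2 < p.1 ∧ p.1 < 1} :=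
      (isOpen_lt continuous_const continuous_snd).inter
        ((isOpen_lt continuous_snd continuous_fst).inter
          (isOpen_lt continuous_fst continuous_const))
    have hsub : {p : ℝ × ℝ | 0 < p.2 ∧ p.2 < p.1 ∧ p.1 < 1} ⊆ U :=
      fun q hq => ⟨hq.1.le, hq.2.1.le, hq.2.2.le⟩
    exact interior_maximal hsub hopen ⟨h0, h1, h2⟩

/-- The cone over `A`, in the homogeneous coordinates `(t, tα, tβ)` with `t > 0`. -/
def coneA : Set (Fin 3 → ℝ) :=
  {v | 0 < v 0 ∧ (v 1 / v 0, v 2 / v 0) ∈ A}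

theorem A_subset : A ⊆ interior U := fun _ hp => mem_iInter.1 hp 0

theorem mapsTo_G_A : MapsTo G A A := fun _ hp => mem_iInter.2 fun n => mem_iInter.1 hp (n + 1)

theorem isBranchInvariant_coneA : IsBranchInvariant coneA where
  pos := by
    rintro v ⟨hv, hA⟩
    obtain ⟨h0, h1, h2⟩ := mem_interior_U.1 (A_subset hA)
    simp only at h0 h1 h2
    rw [div_lt_div_iff_of_pos_right hv] at h1
    rw [div_lt_one hv] at h2
    exact ⟨(div_pos_iff_of_pos_right hv).1 h0, h1, h2⟩
  subset := by
    rintro v ⟨hv, hA⟩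
    have hG := mapsTo_G_A hA
    obtain ⟨h0, h1, h2⟩ := mem_interior_U.1 (A_subset hA)
    simp only at h0 h1 h2
    have hα : 0 < v 1 / v 0 := h0.trans h1
    have hv1 : 0 < v 1 := (div_pos_iff_of_pos_right hv).1 hα
    have hfl : 1 ≤ ⌊1 / (v 1 / v 0)⌋ := by
      rw [Int.le_floor, Int.cast_one, le_div_iff₀ hα]
      linarith
    obtain ⟨k, hk⟩ := Int.eq_ofNat_of_zero_le (sub_nonneg.2 hfl)
    have hk' : (⌊1 / (v 1 / v 0)⌋ : ℝ) = k + 1 := by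
      have := congrArg (Int.cast : ℤ → ℝ) hk
      push_cast at this
      linarith
    refine ⟨k, ![v 1, v 2, (k + 1) * v 1 + v 2 - v 0], ⟨by simpa using hv1, ?_⟩, ?_⟩
    · convert hG using 1
      simp only [G, hk', Matrix.cons_val_zero, Matrix.cons_val_one, Matrix.cons_val]
      ext
      · simp only; field_simp
      · simp only; field_simp; ring
    · rw [toLin'_branchMatrix]
      ext i
      fin_cases i <;> simp

theorem volume_A : volume A = 0 := by
  have hnull : volume (truncation coneA 1 1 1) = 0 :=
    volume_truncation_eq_zero isBranchInvariant_coneA (by constructor <;> norm_num)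
  let e : ℝ × (ℝ × ℝ) ≃ᵐ (Fin 3 → ℝ) :=
    ((MeasurableEquiv.refl ℝ).prodCongr MeasurableEquiv.finTwoArrow.symm).trans
      (MeasurableEquiv.piFinSuccAbove (fun _ : Fin 3 => ℝ) 0).symm
  have he : MeasurePreserving e :=
    ((MeasurePreserving.id volume).prod (volume_preserving_finTwoArrow ℝ).symm).trans
      (volume_preserving_piFinSuccAbove (fun _ : Fin 3 => ℝ) 0).symm
  have hpre : (volume.prod volume) (e ⁻¹' truncation coneA 1 1 1) = 0 := by
    rw [← Measure.volume_eq_prod, he.measure_preimage_equiv, hnull]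
  have hslice := Measure.measure_ae_null_of_prod_null hpre
  have hpos : (volume : Measure ℝ) (Ioo 0 1) ≠ 0 := by simp
  obtain ⟨t, ⟨ht0, ht1⟩, ht⟩ :
      ∃ t ∈ Ioo (0 : ℝ) 1, volume (Prod.mk t ⁻¹' (e ⁻¹' truncation coneA 1 1 1)) = 0 := by
    by_contra! hcon
    exact hpos (measure_mono_null (fun t ht => hcon t ht) hslice)
  -- Below height `1` the form with values `1, 1, 1`, which is `t`, does not truncate: the slice of
  -- the cone at height `t` is `t • A`.
  have hsub : A ⊆ (fun q : ℝ × ℝ => t • q) ⁻¹' (Prod.mk t ⁻¹' (e ⁻¹' truncation coneA 1 1 1)) := by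
    intro q hq
    have hv : e (t, t • q) = ![t, t * q.1, t * q.2] := by
      ext i
      fin_cases i <;> rfl
    simp only [mem_preimage, hv, truncation, coneA, mem_ofPred_eq, Matrix.cons_val_zero,
      Matrix.cons_val_one, Matrix.cons_val]
    rw [mul_div_cancel_left₀ _ ht0.ne', mul_div_cancel_left₀ _ ht0.ne']
    exact ⟨⟨ht0, hq⟩, by linarith⟩
  refine measure_mono_null hsub ?_
  rw [Measure.addHaar_preimage_smul _ ht0.ne', ht, mul_zero]


/-! ### Finite type and renormalization -/

theorem stage_eq_image (f : ℝ → ℝ) (n : ℕ) : stage f n = f^[n] '' Ico 0 1 := by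
  induction n with
  | zero => simp [stage]
  | succ n ih => rw [stage, ih, ← image_comp, Function.iterate_succ']

/-- Finite type means that some set `K` with `f(K) = K` is reached by all points in bounded time. -/
theorem isFiniteType_iff {f : ℝ → ℝ} (hf : MapsTo f (Ico 0 1) (Ico 0 1)) :
    IsFiniteType f ↔ ∃ K ⊆ Ico (0 : ℝ) 1, f '' K = K ∧
      ∃ N : ℕ, ∀ x ∈ Ico (0 : ℝ) 1, ∃ n ≤ N, f^[n] x ∈ K := by
  constructor
  · rintro ⟨n, hn⟩
    refine ⟨stage f n, ?_, hn.symm, n, fun x hx => ⟨n, le_rfl, ?_⟩⟩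
    · rw [stage_eq_image]
      exact (hf.iterate n).image_subset
    · rw [stage_eq_image]
      exact mem_image_of_mem _ hx
  · rintro ⟨K, hK, hfK, N, hN⟩
    have hsub : ∀ n, K ⊆ stage f n := by
      intro n
      induction n with
      | zero => exact hK
      | succ n ih => exact hfK ▸ image_mono ih
    have hmaps : MapsTo f K K := fun x hx => hfK ▸ mem_image_of_mem f hx
    have heq : ∀ m, N ≤ m → stage f m = K := by
      refine fun m hm => Subset.antisymm ?_ (hsub m)
      rw [stage_eq_image]
      rintro _ ⟨x, hx, rfl⟩
      obtain ⟨n, hn, hxn⟩ := hN x hx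
      rw [← Nat.sub_add_cancel (hn.trans hm), Function.iterate_add_apply]
      exact hmaps.iterate _ hxn
    exact ⟨N, by rw [heq N le_rfl, heq (N + 1) N.le_succ]⟩

/-- If `φ` carries `g` to a map induced by `f` with bounded return times, and every point reaches
the image of `φ` in bounded time, then `f` inherits finite type from `g`: if `K` absorbs `g`, the union
of the forward `f`-orbits of `φ '' K` absorbs `f`. -/
theorem IsFiniteType.of_renormalization {f g φ : ℝ → ℝ} (hf : MapsTo f (Ico 0 1) (Ico 0 1))
    (hg : MapsTo g (Ico 0 1) (Ico 0 1)) (hφ : MapsTo φ (Ico 0 1) (Ico 0 1)) (M : ℕ)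
    (hret : ∀ u ∈ Ico (0 : ℝ) 1, ∃ r, 1 ≤ r ∧ r ≤ M ∧ f^[r] (φ u) = φ (g u))
    (hhit : ∀ x ∈ Ico (0 : ℝ) 1, ∃ n ≤ M, ∃ u ∈ Ico (0 : ℝ) 1, f^[n] x = φ u)
    (hfin : IsFiniteType g) : IsFiniteType f := by
  obtain ⟨K, hK, hgK, N, hN⟩ := (isFiniteType_iff hg).1 hfin
  have hiter : ∀ n, ∀ u ∈ Ico (0 : ℝ) 1, ∃ r ≤ n * M, f^[r] (φ u) = φ (g^[n] u) := by
    intro n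
    induction n with
    | zero => exact fun u _ => ⟨0, by simp, rfl⟩
    | succ n ih =>
      intro u hu
      obtain ⟨r, _, hr, hru⟩ := hret u hu
      obtain ⟨s, hs, hsu⟩ := ih (g u) (hg hu)
      refine ⟨s + r, by rw [Nat.succ_mul]; exact add_le_add hs hr, ?_⟩
      rw [Function.iterate_add_apply, hru, hsu, Function.iterate_succ_apply]
  refine (isFiniteType_iff hf).2
    ⟨⋃ i : ℕ, f^[i] '' (φ '' K), ?_, ?_, M + N * M, fun x hx => ?_⟩
  · refine iUnion_subset fun i => ?_
    rintro _ ⟨_, ⟨u, hu, rfl⟩, rfl⟩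
    exact hf.iterate i (hφ (hK hu))
  · rw [image_iUnion]
    apply Subset.antisymm
    · refine iUnion_subset fun i => ?_
      rw [← image_comp, ← Function.iterate_succ']
      exact subset_iUnion (fun i : ℕ => f^[i] '' (φ '' K)) (i + 1)
    · refine iUnion_subset fun i => ?_
      -- A point of `φ '' K` is the return of another one, at a time `r ≥ 1`. This provides a
      -- preimage under `f` also for `i = 0`.
      rintro _ ⟨_, ⟨u, hu, rfl⟩, rfl⟩
      obtain ⟨w, hw, rfl⟩ : u ∈ g '' K := hgK.symm ▸ hu
      obtain ⟨r, hr, _, hrw⟩ := hret w (hK hw)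
      refine mem_iUnion.2 ⟨i + r - 1, f^[i + r - 1] (φ w), ⟨φ w, ⟨w, hw, rfl⟩, rfl⟩, ?_⟩
      rw [← hrw, ← Function.iterate_succ_apply' f, ← Function.iterate_add_apply]
      congr 2
      omega
  · obtain ⟨n, hn, u, hu, hxu⟩ := hhit x hx
    obtain ⟨m, hm, hmu⟩ := hN u hu
    obtain ⟨r, hr, hru⟩ := hiter m u hu
    refine ⟨r + n, ?_, mem_iUnion.2 ⟨0, φ (g^[m] u), ⟨_, hmu, rfl⟩, ?_⟩⟩
    · have := Nat.mul_le_mul_right M hm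
      omega
    · rw [Function.iterate_add_apply, hxu, hru]
      rfl

theorem iterate_eq_add_mul {f : ℝ → ℝ} {a : ℝ} (ha : 0 < a) (hf : ∀ x < 1 - a, f x = x + a)
    {x : ℝ} (n : ℕ) (h : x + n * a < 1) : f^[n] x = x + n * a := by
  induction n with
  | zero => simp
  | succ n ih =>
    push_cast at h ⊢
    rw [Function.iterate_succ_apply', ih (by linarith), hf _ (by linarith)]
    ring

theorem exists_iterate_eq_add_mul {f : ℝ → ℝ} {a : ℝ} (ha : 0 < a)
    (hf : ∀ x < 1 - a, f x = x + a) {x : ℝ} (hx : x ∈ Ico 0 1) :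
    ∃ n ≤ ⌊1 / a⌋₊, f^[n] x = x + n * a ∧ x + n * a ∈ Ico (1 - a) 1 := by
  -- The number of steps is `⌈(1 - x) / a⌉ - 1`.
  obtain ⟨n, hn⟩ := Nat.exists_eq_succ_of_ne_zero
    (Nat.ceil_pos.2 (div_pos (sub_pos.2 hx.2) ha)).ne'
  have h1 : (n : ℝ) < (1 - x) / a := Nat.lt_ceil.1 (by omega)
  have h2 : (1 - x) / a ≤ (n : ℝ) + 1 := by
    have := Nat.le_ceil ((1 - x) / a)
    rw [hn] at this
    exact_mod_cast this
  rw [lt_div_iff₀ ha] at h1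
  rw [div_le_iff₀ ha] at h2
  refine ⟨n, Nat.le_floor ?_, iterate_eq_add_mul ha hf n (by linarith), ?_, by linarith⟩
  · rw [le_div_iff₀ ha]
    linarith [hx.1]
  · linarith

/-! ### The first return map to `[1 - α, 1)` -/

variable {α β : ℝ}

/-- Rescaled to `[0, 1)`, the first return map of `T α β` to `[1 - α, 1)` is translation by `β / α`
on `[0, 1 - β / α)` and by `(β - 1) / α` modulo `1` elsewhere. -/
theorem isFiniteType_T_of_return (h0 : 0 < β) (h1 : β < α) (h2 : α < 1) {g : ℝ → ℝ}
    (hg : MapsTo g (Ico 0 1) (Ico 0 1)) (hg1 : ∀ u < 1 - β / α, g u = u + β / α)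
    (hg2 : ∀ u, 1 - β / α ≤ u → ∃ m : ℤ, g u = u + (β - 1) / α + m)
    (hfin : IsFiniteType g) : IsFiniteType (T α β) := by
  have hα : 0 < α := h0.trans h1
  have hT : MapsTo (T α β) (Ico 0 1) (Ico 0 1) := mapsTo_T ⟨h0.le, h1.le, h2.le⟩
  have hclimb : ∀ x < 1 - α, T α β x = x + α := fun x hx => if_pos hx
  refine IsFiniteType.of_renormalization (φ := fun u => 1 - α + α * u) hT hg ?_ (⌊1 / α⌋₊ + 1)
    ?_ ?_ hfin
  · rintro u ⟨hu0, hu1⟩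
    constructor <;> nlinarith
  · intro u hu
    rcases lt_or_ge u (1 - β / α) with hlt | hge
    · refine ⟨1, le_rfl, by omega, ?_⟩
      have hlt' : α * u < α - β := by
        have := mul_lt_mul_of_pos_left hlt hα
        rwa [mul_sub, mul_div_cancel₀ _ hα.ne', mul_one] at this
      have : 0 ≤ α * u := mul_nonneg hα.le hu.1
      rw [Function.iterate_one, T, if_neg (by linarith), if_pos (by linarith), hg1 u hlt]
      field_simp
      ring
    · have hge' : α - β ≤ α * u := by
        have := mul_le_mul_of_nonneg_left hge hα.le
        rwa [mul_sub, mul_div_cancel₀ _ hα.ne', mul_one] at this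
      have hlt' : α * u < α := by nlinarith [hu.2]
      have hTu : T α β (1 - α + α * u) = 1 - α + α * u + β - 1 := by
        rw [T, if_neg (by linarith), if_neg (by linarith)]
      obtain ⟨n, hn, hiter, hmem⟩ := exists_iterate_eq_add_mul hα hclimb
        (x := 1 - α + α * u + β - 1) ⟨by linarith, by linarith⟩
      refine ⟨n + 1, by omega, by omega, ?_⟩
      obtain ⟨m, hm⟩ := hg2 u hge
      have hgu := hg hu
      -- Both `g u` and the rescaled return point lie in `[0, 1)` and they differ by an integer.
      have hmul : α * g u = α * u + β - 1 + α * m := by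
        rw [hm]
        field_simp
        ring
      have hmn : m = n := by
        have e1 : α * ((m : ℝ) - n) < α * 1 := by nlinarith [hmem.1, hgu.2]
        have e2 : α * (-1) < α * ((m : ℝ) - n) := by nlinarith [hmem.2, hgu.1]
        have e3 := lt_of_mul_lt_mul_left e1 hα.le
        have e4 := lt_of_mul_lt_mul_left e2 hα.le
        have e5 : m - n < 1 := by exact_mod_cast e3
        have e6 : -1 < m - n := by exact_mod_cast e4
        omega
      rw [Function.iterate_succ_apply, hTu, hiter, hmul, hmn]
      push_cast
      ring
  · intro x hx
    obtain ⟨n, hn, hiter, hmem⟩ := exists_iterate_eq_add_mul hα hclimb hx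
    refine ⟨n, by omega, (x + n * α - (1 - α)) / α, ⟨?_, ?_⟩, ?_⟩
    · exact div_nonneg (by linarith [hmem.1]) hα.le
    · rw [div_lt_one hα]
      linarith [hmem.2]
    · rw [hiter]
      field_simp
      ring

theorem isFiniteType_T_of_G (h0 : 0 < β) (h1 : β < α) (h2 : α < 1)
    (hU : G (α, β) ∈ interior U) (hfin : IsFiniteType (T (G (α, β)).1 (G (α, β)).2)) :
    IsFiniteType (T α β) := by
  refine isFiniteType_T_of_return h0 h1 h2 (mapsTo_T (interior_subset hU)) ?_ ?_ hfin
  · exact fun u hu => if_pos hu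
  · intro u hu
    rw [T, if_neg (not_lt.2 hu)]
    split_ifs
    · exact ⟨⌊1 / α⌋, by simp only; ring⟩
    · exact ⟨⌊1 / α⌋ - 1, by simp only; push_cast; ring⟩

/-- The interval `[1 - (a - b), 1)` absorbs every orbit, and the map exchanges its two pieces. -/
theorem isFiniteType_twoInterval {a b : ℝ} (ha0 : 0 < a) (hb : b < 0)
    (hab : a - b < 1) : IsFiniteType (fun u => if u < 1 - a then u + a else u + b) := by
  set g : ℝ → ℝ := fun u => if u < 1 - a then u + a else u + b with hg
  have hg1 : ∀ u < 1 - a, g u = u + a := fun u hu => if_pos hu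
  have hg2 : ∀ u, 1 - a ≤ u → g u = u + b := fun u hu => if_neg (not_lt.2 hu)
  have hmaps : MapsTo g (Ico 0 1) (Ico 0 1) := by
    rintro u ⟨hu0, hu1⟩
    rcases lt_or_ge u (1 - a) with h | h
    · rw [hg1 u h]; constructor <;> linarith
    · rw [hg2 u h]; constructor <;> linarith
  refine (isFiniteType_iff hmaps).2 ⟨Ico (1 - (a - b)) 1, fun u hu => ⟨by linarith [hu.1], hu.2⟩,
    ?_, ⌊1 / a⌋₊, fun x hx => ?_⟩
  · apply Subset.antisymm
    · rintro _ ⟨u, ⟨hu0, hu1⟩, rfl⟩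
      rcases lt_or_ge u (1 - a) with h | h
      · rw [hg1 u h]; constructor <;> linarith
      · rw [hg2 u h]; constructor <;> linarith
    · rintro u ⟨hu0, hu1⟩
      rcases lt_or_ge u (1 + b) with h | h
      · exact ⟨u - b, ⟨by linarith, by linarith⟩, by rw [hg2 _ (by linarith)]; ring⟩
      · exact ⟨u - a, ⟨by linarith, by linarith⟩, by rw [hg1 _ (by linarith)]; ring⟩
  · obtain ⟨n, hn, hiter, hmem⟩ := exists_iterate_eq_add_mul ha0 hg1 hx
    exact ⟨n, hn, by rw [hiter]; exact ⟨by linarith [hmem.1], hmem.2⟩⟩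

theorem isFiniteType_T_of_G_neg (h0 : 0 < β) (h1 : β < α) (h2 : α < 1)
    (hneg : (G (α, β)).2 < 0) : IsFiniteType (T α β) := by
  have hα : 0 < α := h0.trans h1
  have ha0 : 0 < β / α := div_pos h0 hα
  have ha1 : β / α < 1 := (div_lt_one hα).2 h1
  have hab : β / α - (G (α, β)).2 < 1 := by
    have := Int.lt_floor_add_one (1 / α)
    simp only [G, sub_div]
    linarith
  refine isFiniteType_T_of_return h0 h1 h2 ?_ ?_ ?_ (isFiniteType_twoInterval ha0 hneg hab)
  · rintro u ⟨hu0, hu1⟩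
    simp only
    split_ifs <;> constructor <;> linarith
  · exact fun u hu => if_pos hu
  · intro u hu
    exact ⟨⌊1 / α⌋, by simp only [if_neg (not_lt.2 hu), G]; ring⟩

/-! ### Rationally independent parameters -/

/-- The numbers `α`, `β`, `1` are linearly independent over `ℚ`. The conclusion `n = 0` is left out,
as it follows from the other two. -/
def RatIndep (p : ℝ × ℝ) : Prop :=
  ∀ l m n : ℤ, (l : ℝ) * p.1 + m * p.2 + n = 0 → l = 0 ∧ m = 0

theorem ae_ratIndep : ∀ᵐ p : ℝ × ℝ, RatIndep p := by
  simp only [RatIndep, ae_all_iff]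
  intro l m n
  by_cases hlm : l = 0 ∧ m = 0
  · exact Filter.Eventually.of_forall fun _ _ => hlm
  let f : ℝ × ℝ →ₗ[ℝ] ℝ := (l : ℝ) • LinearMap.fst ℝ ℝ ℝ + (m : ℝ) • LinearMap.snd ℝ ℝ ℝ
  have hf : ∀ p : ℝ × ℝ, f p = l * p.1 + m * p.2 := fun p => by simp [f]
  let s : AffineSubspace ℝ (ℝ × ℝ) := (AffineSubspace.mk' (-n : ℝ) ⊥).comap f.toAffineMap
  have hmem : ∀ p, p ∈ s ↔ (l : ℝ) * p.1 + m * p.2 + n = 0 := fun p => by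
    simp [s, hf, AffineSubspace.mem_mk']
  have hs : s ≠ ⊤ := by
    intro htop
    have hall : ∀ p : ℝ × ℝ, (l : ℝ) * p.1 + m * p.2 + n = 0 := fun p =>
      (hmem p).1 (htop ▸ AffineSubspace.mem_top ℝ _ p)
    have e0 := hall (0, 0)
    have e1 := hall (1, 0)
    have e2 := hall (0, 1)
    simp only [mul_zero, mul_one, zero_add, add_zero] at e0 e1 e2
    rw [e0, add_zero] at e1 e2
    exact hlm ⟨by exact_mod_cast e1, by exact_mod_cast e2⟩
  have hnull := Measure.addHaar_affineSubspace (volume : Measure (ℝ × ℝ)) s hs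
  filter_upwards [compl_mem_ae_iff.2 hnull] with p hp h
  exact absurd ((hmem p).2 h) hp

theorem RatIndep.mem_interior_U {p : ℝ × ℝ} (hp : RatIndep p) (hU : p ∈ U) : p ∈ interior U := by
  obtain ⟨h0, h1, h2⟩ := hU
  refine ITM.mem_interior_U.2 ⟨h0.lt_of_ne fun h => ?_, h1.lt_of_ne fun h => ?_,
    h2.lt_of_ne fun h => ?_⟩
  · simpa using (hp 0 1 0 (by simp [← h])).2
  · simpa using (hp 1 (-1) 0 (by simp [← h])).1
  · simpa using (hp 1 0 (-1) (by simp [h])).1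

theorem RatIndep.map_G {p : ℝ × ℝ} (hp : RatIndep p) : RatIndep (G p) := by
  have hp1 : p.1 ≠ 0 := fun h => by simpa using (hp 1 0 0 (by simp [h])).1
  intro l m n h
  simp only [G] at h
  have h' : ((m * ⌊1 / p.1⌋ + n : ℤ) : ℝ) * p.1 + (l + m : ℤ) * p.2 + (-m : ℤ) = 0 := by
    field_simp at h
    push_cast
    linarith
  obtain ⟨e1, e2⟩ := hp _ _ _ h'
  rw [e1, e2] at h'
  have hm : m = 0 := by simpa using h'
  omega

theorem RatIndep.isAperiodic_T {α β : ℝ} (hp : RatIndep (α, β)) : IsAperiodic (T α β) := by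
  have hiter : ∀ (x : ℝ) (n : ℕ), ∃ i j l : ℕ, i + j = n ∧
      (T α β)^[n] x = x + i * α + j * β - l := by
    intro x n
    induction n with
    | zero => exact ⟨0, 0, 0, rfl, by simp⟩
    | succ n ih =>
      obtain ⟨i, j, l, hij, hx⟩ := ih
      rw [Function.iterate_succ_apply', hx, T]
      split_ifs
      · exact ⟨i + 1, j, l, by omega, by push_cast; ring⟩
      · exact ⟨i, j + 1, l, by omega, by push_cast; ring⟩
      · exact ⟨i, j + 1, l + 1, by omega, by push_cast; ring⟩
  rintro x - ⟨n, hn, hper⟩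
  obtain ⟨i, j, l, hij, hx⟩ := hiter x n
  have := hp i j (-l) (by push_cast; linarith [hper.eq])
  omega

/-- By independence the orbit cannot leave the interior of `U` through its boundary, so it leaves
through a negative second coordinate of `G`. -/
theorem RatIndep.isFiniteType_T {p : ℝ × ℝ} (hp : RatIndep p) (hU : p ∈ interior U) (n : ℕ)
    (hn : G^[n] p ∉ interior U) : IsFiniteType (T p.1 p.2) := by
  induction n generalizing p with
  | zero => exact absurd hU hn
  | succ n ih =>
    obtain ⟨h0, h1, h2⟩ := ITM.mem_interior_U.1 hU
    have hα : 0 < p.1 := h0.trans h1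
    rcases lt_or_ge (G p).2 0 with hneg | hnonneg
    · exact isFiniteType_T_of_G_neg h0 h1 h2 hneg
    · have hGU : G p ∈ interior U := by
        refine hp.map_G.mem_interior_U ⟨hnonneg, ?_, ((div_lt_one hα).2 h1).le⟩
        have := Int.floor_le (1 / p.1)
        simp only [G, sub_div]
        linarith
      exact isFiniteType_T_of_G h0 h1 h2 hGU (ih hp.map_G hGU hn)

end ITM

theorem theorem2p6 :
    volume ITM.A = 0 ∧
      ∀ᵐ p : ℝ × ℝ ∂(volume.restrict ITM.U),
        ITM.IsFiniteType (ITM.T p.1 p.2) ∧ ITM.IsAperiodic (ITM.T p.1 p.2) := by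
  refine ⟨ITM.volume_A, ?_⟩
  have hU : MeasurableSet ITM.U :=
    ((isClosed_le continuous_const continuous_snd).inter
      ((isClosed_le continuous_snd continuous_fst).inter
        (isClosed_le continuous_fst continuous_const))).measurableSet
  rw [ae_restrict_iff' hU]
  filter_upwards [ITM.ae_ratIndep, compl_mem_ae_iff.2 ITM.volume_A] with p hp hA hpU
  obtain ⟨n, hn⟩ : ∃ n : ℕ, ITM.G^[n] p ∉ interior ITM.U := by
    simpa [ITM.A] using hA
  exact ⟨hp.isFiniteType_T (hp.mem_interior_U hpU) n hn, hp.isAperiodic_T⟩
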